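/- Let $\mathbf{k}$ be a commutative ring and let $n \geq 0$ be an integer. Let $S_n$ be the symmetric group on $\{1,2,\ldots,n\}$, with multiplication $(\pi\sigma)(i) = \pi(\sigma(i))$. For each $\ell \in \{1,2,\ldots,n\}$, define the element \[ t_\ell := \sum_{j=\ell}^{n} \operatorname{cyc}_{\ell,\ell+1,\ldots,j} \] of the group algebra $\mathbf{k}[S_n]$, where $\operatorname{cyc}_{\ell,\ell+1,\ldots,j} \in S_n$ is the permutation that sends $\ell,\ell+1,\ldots,j-1,j$ to $\ell+1,\ell+2,\ldots,j,\ell$, respectively, and fixes all other elements (so $\operatorname{cyc}_{\ell} = \operatorname{id}$). Then there exists a basis $(b_1,b_2,\ldots,b_{n!})$ of the $\mathbf{k}$-module $\mathbf{k}[S_n]$ such that for all $\lambda_1,\lambda_2,\ldots,\lambda_n \in \mathbf{k}$, the $\mathbf{k}$-module endomorphism \[ \mathbf{k}[S_n] \to \mathbf{k}[S_n], \qquad y \mapsto y\,(\lambda_1 t_1 + \lambda_2 t_2 + \cdots + \lambda_n t_n) \] is represented by an upper-triangular matrix with respect to this basis. (In particular, the basis does not depend on $\lambda_1,\lambda_2,\ldots,\lambda_n$.)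 -/

import Mathlib

/-- The somewhere-to-below shuffle `t_ℓ` in the group algebra `k[S_n]`: the sum of the cycles
`(ℓ, ℓ+1, …, j)` over all `j ≥ ℓ`. The set `{1, …, n}` is modelled by `Fin n`, and
`Fin.cycleIcc ℓ j` sends `ℓ, ℓ+1, …, j-1, j` to `ℓ+1, ℓ+2, …, j, ℓ` and fixes all other elements. -/
noncomputable def somewhereToBelow (k : Type*) [CommRing k] {n : ℕ} (l : Fin n) :
    MonoidAlgebra k (Equiv.Perm (Fin n)) :=
  ∑ j ∈ Finset.Ici l, MonoidAlgebra.of k (Equiv.Perm (Fin n)) (Fin.cycleIcc l j)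

/-! The spaces `invariants k n K` filter the group algebra, `K` having weight `∑ x ∈ K, x`. On each
of them every `t_l` acts as a scalar modulo spaces of smaller weight: if `r` is the first position
from `l` on that belongs to `K`, the cycles stopping before `r` fix the invariants and give the
scalar, while the remaining cycles land in lighter spaces (`mul_somewhereToBelow_mem`). The elements
`descentDestroying k w` form a basis adapted to this filtration: those with `w` descending off `K`
span `invariants k n K` (`mem_span_of_mem_invariants`). The leading coefficients are `1`, so any `k`
will do. Sorting by `weight` makes all the `t_l` triangular at once. -/

open Equiv

namespace SomewhereToBelow

/-! ### Products of cycles and adjacent transpositions. -/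

section Cycles

variable {n : ℕ}

theorem cycleIcc_apply_of_le_of_lt {l j a b : Fin n} (hla : l ≤ a) (haj : a < j)
    (hab : b.val = a.val + 1) : Fin.cycleIcc l j a = b := by
  have : NeZero n := ⟨by have := l.isLt; omega⟩
  rw [Fin.cycleIcc_of_ge_of_lt hla haj]
  ext
  rw [Fin.val_add_one_of_lt' (by have := b.isLt; omega), hab]

theorem cycleIcc_self (l : Fin n) : Fin.cycleIcc l l = 1 := by
  have : NeZero n := ⟨by have := l.isLt; omega⟩
  exact Fin.cycleIcc_eq

theorem cycleIcc_mul_cycleIcc {i j l : Fin n} (hij : i ≤ j) (hjl : j ≤ l) :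
    Fin.cycleIcc i j * Fin.cycleIcc j l = Fin.cycleIcc i l := by
  have : NeZero n := ⟨by have := i.isLt; omega⟩
  ext x
  rw [Perm.mul_apply, ← Function.comp_apply (f := Fin.cycleIcc i j), Fin.cycleIcc.trans hij hjl]

theorem cycleIcc_of_val_eq_add_one {a b : Fin n} (hab : b.val = a.val + 1) :
    Fin.cycleIcc a b = swap a b := by
  have : NeZero n := ⟨by have := a.isLt; omega⟩
  have hlt : a < b := by rw [Fin.lt_def]; omega
  ext1 x
  rcases lt_trichotomy x a with h | rfl | h
  · rw [Fin.cycleIcc_of_lt h, swap_apply_of_ne_of_ne h.ne (h.trans hlt).ne]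
  · rw [cycleIcc_apply_of_le_of_lt le_rfl hlt hab, swap_apply_left]
  · rcases eq_or_ne x b with rfl | hx
    · rw [Fin.cycleIcc_of_last hlt.le, swap_apply_right]
    · have : b < x := by
        rw [Fin.lt_def] at h ⊢
        have := Fin.val_ne_of_ne hx
        omega
      rw [Fin.cycleIcc_of_gt this, swap_apply_of_ne_of_ne h.ne' hx]

theorem cycleIcc_mul_swap_right {l a b : Fin n} (hla : l ≤ a) (hab : b.val = a.val + 1) :
    Fin.cycleIcc l a * swap a b = Fin.cycleIcc l b := by
  rw [← cycleIcc_of_val_eq_add_one hab,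
    cycleIcc_mul_cycleIcc hla (by rw [Fin.le_def]; omega)]

theorem cycleIcc_mul_swap_of_lt {l j a b : Fin n} (ha : a < l) (hb : b < l) :
    Fin.cycleIcc l j * swap a b = swap a b * Fin.cycleIcc l j := by
  rw [mul_swap_eq_swap_mul, Fin.cycleIcc_of_lt ha, Fin.cycleIcc_of_lt hb]

theorem cycleIcc_mul_swap_of_gt {l j a b : Fin n} (ha : j < a) (hb : j < b) :
    Fin.cycleIcc l j * swap a b = swap a b * Fin.cycleIcc l j := by
  rw [mul_swap_eq_swap_mul, Fin.cycleIcc_of_gt ha, Fin.cycleIcc_of_gt hb]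

theorem cycleIcc_mul_swap_of_mem {l j a b c : Fin n} (hla : l ≤ a) (hbj : b < j)
    (hab : b.val = a.val + 1) (hbc : c.val = b.val + 1) :
    Fin.cycleIcc l j * swap a b = swap b c * Fin.cycleIcc l j := by
  rw [Fin.le_def] at hla
  rw [Fin.lt_def] at hbj
  rw [mul_swap_eq_swap_mul,
    cycleIcc_apply_of_le_of_lt (by rw [Fin.le_def]; omega) (by rw [Fin.lt_def]; omega) hab,
    cycleIcc_apply_of_le_of_lt (by rw [Fin.le_def]; omega) (by rw [Fin.lt_def]; omega) hbc]

end Cycles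

/-! ### Decreasing runs and the lexicographic order. -/

section Descents

variable {n : ℕ}

/-- All adjacent pairs of positions, numbered from `1`, that avoid `K` are descents of `w`. -/
def DescendsOff (K : Finset ℕ) (w : Perm (Fin n)) : Prop :=
  ∀ a b : Fin n, b.val = a.val + 1 → a.val + 1 ∉ K → b.val + 1 ∉ K → w b < w a

open Classical in
/-- The ascents of `w` that lie before position `x`. -/
noncomputable def ascentsBefore (w : Perm (Fin n)) (x : Fin n) : Finset (Fin n) :=
  {c | c < x ∧ ∃ d : Fin n, d.val = c.val + 1 ∧ w c < w d}

theorem mem_ascentsBefore {w : Perm (Fin n)} {x c : Fin n} :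
    c ∈ ascentsBefore w x ↔ c < x ∧ ∃ d : Fin n, d.val = c.val + 1 ∧ w c < w d := by
  simp [ascentsBefore]

theorem ascentsBefore_eq_of_descent {w : Perm (Fin n)} {a b : Fin n} (hab : b.val = a.val + 1)
    (h : w b < w a) : ascentsBefore w b = ascentsBefore w a := by
  ext c
  rw [mem_ascentsBefore, mem_ascentsBefore, Fin.lt_def, Fin.lt_def]
  refine and_congr_left fun ⟨d, hd, hcd⟩ => ⟨fun hc => ?_, fun hc => by omega⟩
  by_contra hca
  obtain rfl : c = a := Fin.ext (by omega)
  obtain rfl : d = b := Fin.ext (by omega)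
  exact absurd hcd h.asymm

/-- Equal sets mean that no ascent separates `x` from `y`: both lie in one decreasing run. -/
theorem lt_of_ascentsBefore_eq {w : Perm (Fin n)} {x : Fin n} (d : ℕ) (y : Fin n)
    (hy : y.val = x.val + d + 1) (h : ascentsBefore w y = ascentsBefore w x) : w y < w x := by
  have hlt := y.isLt
  let p : Fin n := ⟨x.val + d, by omega⟩
  have hpy : w y < w p := by
    have hne : w p ≠ w y := fun e => by
      have := congrArg Fin.val (w.injective e)
      simp only [p] at this
      omega
    by_contra hcon
    have hp : p ∈ ascentsBefore w y := mem_ascentsBefore.2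
      ⟨by rw [Fin.lt_def]; simp only [p]; omega, y, hy, lt_of_le_of_ne (not_lt.1 hcon) hne⟩
    rw [h, mem_ascentsBefore, Fin.lt_def] at hp
    have := hp.1
    simp only [p] at this
    omega
  cases d with
  | zero => exact hpy
  | succ d =>
    exact hpy.trans (lt_of_ascentsBefore_eq d p rfl
      ((ascentsBefore_eq_of_descent (a := p) (b := y) hy hpy).symm.trans h))

/-- At the first `x` where `u` and `w` differ, the value `u x` sits in `w` later than `x`, as the
earlier values are used up, and in the same decreasing run; hence `u x < w x`. -/
theorem toLex_le_of_ascentsBefore_eq {w u : Perm (Fin n)}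
    (h : ∀ x, ascentsBefore w (w⁻¹ (u x)) = ascentsBefore w x) : toLex ⇑u ≤ toLex ⇑w := by
  by_cases huw : u = w
  · rw [huw]
  have hex : ∃ x, u x ≠ w x := by
    by_contra! hall
    exact huw (Equiv.ext hall)
  obtain ⟨x, hx, hmin⟩ := wellFounded_lt.has_min {x | u x ≠ w x} hex
  have hmin' : ∀ y < x, u y = w y := fun y hy => by
    by_contra hne
    exact hmin y hne hy
  refine le_of_lt ⟨x, hmin', ?_⟩
  have hinv : w (w⁻¹ (u x)) = u x := w.apply_symm_apply _
  have hlt : x < w⁻¹ (u x) := by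
    rcases lt_trichotomy x (w⁻¹ (u x)) with hlt | heq | hgt
    · exact hlt
    · refine absurd ?_ hx
      conv_rhs => rw [heq]
      simp
    · have := hmin' _ hgt
      rw [hinv] at this
      exact absurd (u.injective this) hgt.ne
  rw [Fin.lt_def] at hlt
  have := lt_of_ascentsBefore_eq (w := w) (x := x) ((w⁻¹ (u x)).val - x.val - 1) (w⁻¹ (u x))
    (by omega) (h x)
  rwa [hinv] at this

theorem toLex_lt_mul_swap {w : Perm (Fin n)} {a b : Fin n} (hab : a < b) (h : w a < w b) :
    toLex ⇑w < toLex ⇑(w * swap a b) := by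
  refine ⟨a, fun j hj => ?_, ?_⟩
  · change w j = w (swap a b j)
    rw [swap_apply_of_ne_of_ne hj.ne (hj.trans hab).ne]
  · change w a < w (swap a b a)
    rwa [swap_apply_left]

/-- The least weight `∑ x ∈ K, x` of a set `K` such that `w` descends off `K`. -/
noncomputable def weight (w : Perm (Fin n)) : ℕ :=
  sInf {s | ∃ K : Finset ℕ, DescendsOff K w ∧ ∑ x ∈ K, x = s}

theorem weight_le {w : Perm (Fin n)} {K : Finset ℕ} (h : DescendsOff K w) :
    weight w ≤ ∑ x ∈ K, x :=
  Nat.sInf_le ⟨K, h, rfl⟩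

theorem exists_sum_eq_weight (w : Perm (Fin n)) :
    ∃ K : Finset ℕ, DescendsOff K w ∧ ∑ x ∈ K, x = weight w := by
  refine Nat.sInf_mem (s := {s | ∃ K : Finset ℕ, DescendsOff K w ∧ ∑ x ∈ K, x = s})
    ⟨_, Finset.range (n + 1), fun a b _ ha _ => absurd ?_ ha, rfl⟩
  exact Finset.mem_range.2 (by omega)

end Descents

/-! ### Invariant spaces and the action of the shuffles on them. -/

variable {k : Type*} [CommRing k] {n : ℕ}

local notation "ι" => MonoidAlgebra.of k (Perm (Fin n))

/-- The elements of the group algebra fixed under right multiplication by each adjacent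
transposition of two positions, numbered from `1`, neither of which lies in `K`. -/
def invariants (k : Type*) [CommRing k] (n : ℕ) (K : Finset ℕ) :
    Submodule k (MonoidAlgebra k (Perm (Fin n))) where
  carrier := {q | ∀ a b : Fin n, b.val = a.val + 1 → a.val + 1 ∉ K → b.val + 1 ∉ K →
    q * MonoidAlgebra.of k _ (swap a b) = q}
  add_mem' hp hq a b hab ha hb := by rw [add_mul, hp a b hab ha hb, hq a b hab ha hb]
  zero_mem' _ _ _ _ _ := zero_mul _
  smul_mem' c q hq a b hab ha hb := by rw [smul_mul_assoc, hq a b hab ha hb]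

theorem mul_cycleIcc_of_mem_invariants {K : Finset ℕ} {q : MonoidAlgebra k (Perm (Fin n))}
    (hq : q ∈ invariants k n K) (l : Fin n) (d : ℕ) (j : Fin n) (hj : j.val = l.val + d)
    (hK : ∀ x, l ≤ x → x ≤ j → x.val + 1 ∉ K) : q * ι (Fin.cycleIcc l j) = q := by
  induction d generalizing j with
  | zero =>
    obtain rfl : j = l := Fin.ext hj
    rw [cycleIcc_self, map_one, mul_one]
  | succ d ih =>
    have hlt := j.isLt
    let i : Fin n := ⟨l.val + d, by omega⟩
    have hij : j.val = i.val + 1 := by simp only [i]; omega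
    have hli : l ≤ i := by rw [Fin.le_def]; simp only [i]; omega
    have hij' : i ≤ j := by rw [Fin.le_def]; omega
    rw [← cycleIcc_mul_swap_right hli hij, map_mul, ← mul_assoc,
      ih i rfl fun x hx hxi => hK x hx (hxi.trans hij')]
    exact hq i j hij (hK i hli hij') (hK j (hli.trans hij') le_rfl)

/-- The insertion of a singleton position into the block that follows it. -/
theorem sum_mul_cycleIcc_mem_invariants {K : Finset ℕ} {q : MonoidAlgebra k (Perm (Fin n))}
    (hq : q ∈ invariants k n K) (m : Fin n) (hm : m.val ∈ K) :
    ∑ j : Fin n with m ≤ j ∧ ∀ x, m < x → x ≤ j → x.val + 1 ∉ K, q * ι (Fin.cycleIcc m j) ∈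
      invariants k n (K.erase (m.val + 1)) := by
  intro a b hab ha hb
  have hb' : b ≠ m := by
    rintro rfl
    apply ha
    rw [Finset.mem_erase, ← hab]
    exact ⟨by omega, hm⟩
  have hbm := Fin.val_ne_of_ne hb'
  have hbK : b.val + 1 ∉ K := fun h => hb (Finset.mem_erase.2 ⟨by omega, h⟩)
  have haK : a ≠ m → a.val + 1 ∉ K := fun h h' =>
    ha (Finset.mem_erase.2 ⟨by have := Fin.val_ne_of_ne h; omega, h'⟩)
  rw [Finset.sum_mul]
  by_cases hlt : b < m
  · have ham : a < m := by rw [Fin.lt_def] at hlt ⊢; omega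
    refine Finset.sum_congr rfl fun j _ => ?_
    rw [mul_assoc, ← map_mul, cycleIcc_mul_swap_of_lt ham hlt, map_mul, ← mul_assoc,
      hq a b hab (haK ham.ne) hbK]
  have hma : m ≤ a := by rw [Fin.lt_def] at hlt; rw [Fin.le_def]; omega
  have hal : a < b := by rw [Fin.lt_def]; omega
  -- Since `b` avoids `K`, the range of summation cannot end between `a` and `b`; the swap exchanges
  -- the summands at `a` and `b` and fixes the others.
  have hU : ∀ j, (m ≤ swap a b j ∧ ∀ x, m < x → x ≤ swap a b j → x.val + 1 ∉ K) ↔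
      (m ≤ j ∧ ∀ x, m < x → x ≤ j → x.val + 1 ∉ K) := by
    have key : (∀ x, m < x → x ≤ b → x.val + 1 ∉ K) ↔ (∀ x, m < x → x ≤ a → x.val + 1 ∉ K) := by
      refine ⟨fun h x hx hxa => h x hx (hxa.trans hal.le), fun h x hx hxb => ?_⟩
      rcases eq_or_ne x b with rfl | hne
      · exact hbK
      · refine h x hx ?_
        have := Fin.val_ne_of_ne hne
        rw [Fin.le_def] at hxb ⊢
        omega
    intro j
    rcases eq_or_ne j a with rfl | hja
    · rw [swap_apply_left]
      simp only [hma, hma.trans hal.le, true_and, key]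
    rcases eq_or_ne j b with rfl | hjb
    · rw [swap_apply_right]
      simp only [hma, hma.trans hal.le, true_and, key]
    rw [swap_apply_of_ne_of_ne hja hjb]
  refine Finset.sum_equiv (swap a b) (fun j => by simp [hU]) fun j hj => ?_
  obtain ⟨hmj, hjK⟩ := (Finset.mem_filter.1 hj).2
  rw [mul_assoc, ← map_mul]
  rcases eq_or_ne j a with rfl | hja
  · rw [swap_apply_left, cycleIcc_mul_swap_right hma hab]
  rcases eq_or_ne j b with rfl | hjb
  · rw [swap_apply_right, ← cycleIcc_mul_swap_right hma hab, mul_assoc, swap_mul_self, mul_one]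
  rw [swap_apply_of_ne_of_ne hja hjb]
  have h1 := Fin.val_ne_of_ne hja
  have h2 := Fin.val_ne_of_ne hjb
  by_cases hlt' : j < a
  · rw [cycleIcc_mul_swap_of_gt hlt' (hlt'.trans hal), map_mul, ← mul_assoc,
      hq a b hab (haK (hmj.trans_lt hlt').ne') hbK]
  · rw [Fin.lt_def] at hlt'
    have hjn := j.isLt
    let c : Fin n := ⟨b.val + 1, by omega⟩
    have hbj : b < j := by rw [Fin.lt_def]; omega
    have hcj : c ≤ j := by rw [Fin.le_def]; simp only [c]; omega
    have hmc : m < c := by rw [Fin.lt_def]; rw [Fin.le_def] at hma; simp only [c]; omega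
    rw [cycleIcc_mul_swap_of_mem (c := c) hma hbj hab rfl, map_mul, ← mul_assoc,
      hq b c rfl hbK (hjK c hmc hcj)]

/-- The block between `m` and `r` moves one place left, onto the freed position `m`; the entries
from `r` and `m` end up as singletons at the last two positions of the cycle. -/
theorem mul_cycleIcc_mem_invariants {K : Finset ℕ} {q : MonoidAlgebra k (Perm (Fin n))}
    (hq : q ∈ invariants k n K) {m r : Fin n} (hm : m.val ∈ K) (hmr : m < r)
    (hr : r.val + 1 ∈ K) (hK : ∀ x, m < x → x < r → x.val + 1 ∉ K) :
    q * ι (Fin.cycleIcc m r) ∈ invariants k n (insert r.val (K.erase (m.val + 1))) := by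
  intro a b hab ha hb
  rw [Fin.lt_def] at hmr
  simp only [Finset.mem_insert, Finset.mem_erase, not_or, not_and] at ha hb
  have hbm : b.val ≠ m.val := fun h => ha.2 (by omega) (by rwa [← hab, h])
  have har : a.val ≠ r.val := fun h => ha.2 (by omega) (by rwa [h])
  have hbr : b.val ≠ r.val := fun h => hb.2 (by omega) (by rwa [h])
  have hbK : b.val + 1 ∉ K := hb.2 (by omega)
  rw [mul_assoc, ← map_mul]
  by_cases h1 : b < m
  · have h1' := Fin.lt_def.1 h1
    rw [cycleIcc_mul_swap_of_lt (by rw [Fin.lt_def]; omega) h1, map_mul, ← mul_assoc,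
      hq a b hab (ha.2 (by omega)) hbK]
  by_cases h2 : r < a
  · have h2' := Fin.lt_def.1 h2
    rw [cycleIcc_mul_swap_of_gt h2 (by rw [Fin.lt_def]; omega), map_mul, ← mul_assoc,
      hq a b hab (ha.2 (by omega)) hbK]
  rw [Fin.lt_def] at h1 h2
  have hrn := r.isLt
  let c : Fin n := ⟨b.val + 1, by omega⟩
  rw [cycleIcc_mul_swap_of_mem (c := c) (by rw [Fin.le_def]; omega) (by rw [Fin.lt_def]; omega)
    hab rfl, map_mul, ← mul_assoc, hq b c rfl hbK
    (hK c (by rw [Fin.lt_def]; simp only [c]; omega) (by rw [Fin.lt_def]; simp only [c]; omega))]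

/-- Splitting off the cycles that reach position `r`. -/
theorem mul_somewhereToBelow_eq_add {q : MonoidAlgebra k (Perm (Fin n))} {l r : Fin n}
    (hlr : l ≤ r) (P : Fin n → Prop) [DecidablePred P] (hP : ∀ j, P j ↔ l ≤ j ∧ j < r) :
    q * somewhereToBelow k l =
      ∑ j with P j, q * ι (Fin.cycleIcc l j) +
        q * ι (Fin.cycleIcc l r) * somewhereToBelow k r := by
  have hdisj : Disjoint (Finset.univ.filter P) (Finset.Ici r) := by
    rw [Finset.disjoint_left]
    intro j hj hj'
    exact absurd (Finset.mem_Ici.1 hj') (not_le.2 ((hP j).1 (Finset.mem_filter.1 hj).2).2)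
  have hunion : Finset.Ici l = Finset.univ.filter P ∪ Finset.Ici r := by
    ext j
    simp only [Finset.mem_Ici, Finset.mem_union, Finset.mem_filter, Finset.mem_univ, true_and, hP]
    refine ⟨fun h => (lt_or_ge j r).imp (⟨h, ·⟩) id, ?_⟩
    rintro (h | h)
    exacts [h.1, hlr.trans h]
  rw [somewhereToBelow, hunion, Finset.mul_sum, Finset.sum_union hdisj, somewhereToBelow,
    Finset.mul_sum]
  congr 1
  refine Finset.sum_congr rfl fun j hj => ?_
  rw [mul_assoc, ← map_mul, cycleIcc_mul_cycleIcc hlr (Finset.mem_Ici.1 hj)]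

/-- As `m.val` and `m.val + 1` lie in `K`, position `m` is a singleton. The cycles stopping before
the next `r` in `K` insert it symmetrically into the following block, which removes `m.val + 1` from
the weight. The other cycles factor through `r`: the weight loses `m.val + 1` and gains at most
`r.val`, so the same bound holds at `r`. -/
theorem mul_somewhereToBelow_mem {L : Submodule k (MonoidAlgebra k (Perm (Fin n)))} {s : ℕ}
    (hL : ∀ K : Finset ℕ, ∑ x ∈ K, x < s → invariants k n K ≤ L) (m : Fin n) (K : Finset ℕ)
    {q : MonoidAlgebra k (Perm (Fin n))} (hq : q ∈ invariants k n K) (hm : m.val ∈ K)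
    (hm' : m.val + 1 ∈ K) (hs : ∑ x ∈ K, x < s + (m.val + 1)) :
    q * somewhereToBelow k m ∈ L := by
  have herase := Finset.add_sum_erase K (fun x => x) hm'
  have hfirst := hL _ (by omega) (sum_mul_cycleIcc_mem_invariants hq m hm)
  by_cases hr : ∃ r : Fin n, m < r ∧ r.val + 1 ∈ K
  · obtain ⟨r, ⟨hmr, hrK⟩, hmin⟩ := wellFounded_lt.has_min {r : Fin n | m < r ∧ r.val + 1 ∈ K} hr
    have hmin' : ∀ x, m < x → x < r → x.val + 1 ∉ K := fun x hx hxr hxK => hmin x ⟨hx, hxK⟩ hxr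
    rw [mul_somewhereToBelow_eq_add hmr.le
      (fun j => m ≤ j ∧ ∀ x, m < x → x ≤ j → x.val + 1 ∉ K) fun j => ?_]
    · refine L.add_mem hfirst (mul_somewhereToBelow_mem hL r _
        (mul_cycleIcc_mem_invariants hq hm hmr hrK hmin') (Finset.mem_insert_self _ _)
        (Finset.mem_insert_of_mem (Finset.mem_erase.2 ⟨?_, hrK⟩)) ?_)
      · rw [Fin.lt_def] at hmr; omega
      · have : ∑ x ∈ insert r.val (K.erase (m.val + 1)), x ≤
            r.val + ∑ x ∈ K.erase (m.val + 1), x := by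
          by_cases h : r.val ∈ K.erase (m.val + 1)
          · rw [Finset.insert_eq_of_mem h]; omega
          · rw [Finset.sum_insert h]
        omega
    · refine and_congr_right fun _ => ⟨fun h => not_le.1 fun hrj => h r hmr hrj hrK, ?_⟩
      exact fun h x hx hxj => hmin' x hx (hxj.trans_lt h)
  · push Not at hr
    convert hfirst using 1
    rw [somewhereToBelow, Finset.mul_sum]
    refine Finset.sum_congr ?_ fun _ _ => rfl
    ext j
    simp only [Finset.mem_Ici, Finset.mem_filter, Finset.mem_univ, true_and]
    exact ⟨fun h => ⟨h, fun x hx _ => hr x hx⟩, fun h => h.1⟩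
termination_by n - m.val
decreasing_by rw [Fin.lt_def] at hmr; omega

/-- On the invariants of `K`, the shuffle `t_l` acts as a scalar up to elements of smaller
invariant spaces. -/
theorem exists_mul_somewhereToBelow_sub_smul_mem
    {L : Submodule k (MonoidAlgebra k (Perm (Fin n)))} (K : Finset ℕ)
    (hL : ∀ J : Finset ℕ, ∑ x ∈ J, x < ∑ x ∈ K, x → invariants k n J ≤ L) (l : Fin n) :
    ∃ c : k, ∀ q ∈ invariants k n K, q * somewhereToBelow k l - c • q ∈ L := by
  by_cases hr : ∃ r : Fin n, l ≤ r ∧ r.val + 1 ∈ K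
  · obtain ⟨r, ⟨hlr, hrK⟩, hmin⟩ := wellFounded_lt.has_min {r : Fin n | l ≤ r ∧ r.val + 1 ∈ K} hr
    have hmin' : ∀ x, l ≤ x → x < r → x.val + 1 ∉ K := fun x hx hxr hxK => hmin x ⟨hx, hxK⟩ hxr
    refine ⟨((Finset.univ.filter fun j => l ≤ j ∧ j < r).card : k), fun q hq => ?_⟩
    have hsum : ∑ j with l ≤ j ∧ j < r, q * ι (Fin.cycleIcc l j) =
        ((Finset.univ.filter fun j => l ≤ j ∧ j < r).card : k) • q := by
      rw [Nat.cast_smul_eq_nsmul, ← Finset.sum_const]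
      refine Finset.sum_congr rfl fun j hj => ?_
      obtain ⟨hlj, hjr⟩ := (Finset.mem_filter.1 hj).2
      exact mul_cycleIcc_of_mem_invariants hq l (j.val - l.val) j
        (by rw [Fin.le_def] at hlj; omega) fun x hx hxj => hmin' x hx (hxj.trans_lt hjr)
    rw [mul_somewhereToBelow_eq_add hlr (fun j => l ≤ j ∧ j < r) fun _ => Iff.rfl, hsum,
      add_sub_cancel_left]
    -- Inserting `r.val` costs at most `r.val`, just under the allowed `r.val + 1`. For `r.val = 0`
    -- the inserted `0` numbers no position.
    refine mul_somewhereToBelow_mem hL r (insert r.val K) ?_ (Finset.mem_insert_self _ _)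
      (Finset.mem_insert_of_mem hrK) ?_
    · rcases hlr.eq_or_lt with rfl | hlt
      · rw [cycleIcc_self, map_one, mul_one]
        exact fun a b hab ha hb => hq a b hab (fun h => ha (Finset.mem_insert_of_mem h))
          fun h => hb (Finset.mem_insert_of_mem h)
      · rw [Fin.lt_def] at hlt
        have hrn := r.isLt
        let p : Fin n := ⟨r.val - 1, by omega⟩
        have hpr : r.val = p.val + 1 := by simp only [p]; omega
        have hlp : l ≤ p := by rw [Fin.le_def]; omega
        -- All factors of the cycle but `swap p r` are absorbed by `q`, and `swap p r` commutes with
        -- the transpositions avoiding `p` and `r`.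
        rw [← cycleIcc_mul_swap_right hlp hpr, map_mul, ← mul_assoc,
          mul_cycleIcc_of_mem_invariants hq l (p.val - l.val) p (by rw [Fin.le_def] at hlp; omega)
            fun x hx hxp => hmin' x hx (by rw [Fin.le_def] at hxp; rw [Fin.lt_def]; omega)]
        intro a b hab ha hb
        simp only [Finset.mem_insert, not_or] at ha hb
        have har : a.val ≠ r.val := fun h => ha.2 (by rwa [h])
        have hbr : b.val ≠ r.val := fun h => hb.2 (by rwa [h])
        have hne {x y : Fin n} (h : x.val ≠ y.val) : x ≠ y := fun h' => h (by rw [h'])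
        rw [mul_assoc, ← map_mul, mul_swap_eq_swap_mul,
          swap_apply_of_ne_of_ne (hne (by omega)) (hne har),
          swap_apply_of_ne_of_ne (hne (by omega)) (hne hbr), map_mul, ← mul_assoc,
          hq a b hab ha.2 hb.2]
    · by_cases h : r.val ∈ K
      · rw [Finset.insert_eq_of_mem h]; omega
      · rw [Finset.sum_insert h]; omega
  · push Not at hr
    refine ⟨((Finset.Ici l).card : k), fun q hq => ?_⟩
    convert L.zero_mem
    rw [sub_eq_zero, somewhereToBelow, Finset.mul_sum, Nat.cast_smul_eq_nsmul,
      ← Finset.sum_const]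
    refine Finset.sum_congr rfl fun j hj => ?_
    have hlj := Finset.mem_Ici.1 hj
    exact mul_cycleIcc_of_mem_invariants hq l (j.val - l.val) j
      (by rw [Fin.le_def] at hlj; omega) fun x hx _ => hr x hx

/-! ### The descent-destroying basis. -/

open Classical in
/-- The descent-destroying element of `w`: the sum of all permutations obtained from `w` by
permuting positions within the maximal decreasing runs. -/
noncomputable def descentDestroying (k : Type*) [CommRing k] {n : ℕ} (w : Perm (Fin n)) :
    MonoidAlgebra k (Perm (Fin n)) :=
  ∑ u : Perm (Fin n) with ∀ x, ascentsBefore w (w⁻¹ (u x)) = ascentsBefore w x,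
    MonoidAlgebra.of k _ u

open Classical in
theorem coeff_descentDestroying (w v : Perm (Fin n)) :
    (descentDestroying k w).coeff v =
      if ∀ x, ascentsBefore w (w⁻¹ (v x)) = ascentsBefore w x then 1 else 0 := by
  simp [descentDestroying, MonoidAlgebra.coeff_sum, Finsupp.finsetSum_apply,
    MonoidAlgebra.of_apply, Finsupp.single_apply, Finset.sum_ite_eq']

theorem coeff_descentDestroying_self (w : Perm (Fin n)) :
    (descentDestroying k w).coeff w = 1 := by
  simp [coeff_descentDestroying]

theorem toLex_le_of_coeff_descentDestroying_ne_zero {w v : Perm (Fin n)}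
    (h : (descentDestroying k w).coeff v ≠ 0) : toLex ⇑v ≤ toLex ⇑w := by
  rw [coeff_descentDestroying] at h
  exact toLex_le_of_ascentsBefore_eq (by by_contra hcon; exact h (if_neg hcon))

theorem coeff_mul_swap (q : MonoidAlgebra k (Perm (Fin n))) (a b : Fin n) (v : Perm (Fin n)) :
    (q * MonoidAlgebra.of k _ (swap a b)).coeff v = q.coeff (v * swap a b) := by
  rw [MonoidAlgebra.of_apply, MonoidAlgebra.coeff_mul_single_apply, mul_one, swap_inv]

theorem descentDestroying_mem_invariants {K : Finset ℕ} {w : Perm (Fin n)}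
    (hw : DescendsOff K w) : descentDestroying k w ∈ invariants k n K := by
  intro a b hab ha hb
  have hasc : ∀ x, ascentsBefore w (swap a b x) = ascentsBefore w x := by
    have h := ascentsBefore_eq_of_descent hab (hw a b hab ha hb)
    intro x
    rw [swap_apply_def]
    split_ifs with h1 h2
    · rw [h1, h]
    · rw [h2, h]
    · rfl
  ext v
  rw [coeff_mul_swap, coeff_descentDestroying, coeff_descentDestroying]
  congr 1
  refine propext ⟨fun h x => ?_, fun h x => ?_⟩
  · have := h (swap a b x)
    rwa [Perm.mul_apply, swap_apply_self, hasc] at this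
  · rw [Perm.mul_apply, h, hasc]

/-- Elimination of lexicographic leading terms: `w` is the largest permutation in `descentDestroying
k w`, with coefficient `1`. -/
theorem mem_span_of_mem_invariants {K : Finset ℕ} {q : MonoidAlgebra k (Perm (Fin n))}
    (hq : q ∈ invariants k n K) :
    q ∈ Submodule.span k (descentDestroying k '' {w | DescendsOff K w}) := by
  set L := Submodule.span k (descentDestroying k '' {w : Perm (Fin n) | DescendsOff K w})
  let P (w : Perm (Fin n)) : Prop := ∀ q ∈ invariants k n K,
    (∀ v, q.coeff v ≠ 0 → toLex ⇑v < toLex ⇑w) → q ∈ L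
  have key : ∀ q ∈ invariants k n K, (∀ w, q.coeff w ≠ 0 → P w) → q ∈ L := by
    intro q hq hP
    by_cases h0 : q = 0
    · exact h0 ▸ L.zero_mem
    have hne : q.coeff.support.Nonempty := by
      rw [Finsupp.support_nonempty_iff]
      exact fun h => h0 (MonoidAlgebra.ext h)
    obtain ⟨w, hw, hmax⟩ := q.coeff.support.exists_max_image (fun v => toLex ⇑v) hne
    have hmax' : ∀ v, q.coeff v ≠ 0 → toLex ⇑v ≤ toLex ⇑w := fun v hv =>
      hmax v (Finsupp.mem_support_iff.2 hv)
    have hw0 := Finsupp.mem_support_iff.1 hw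
    -- At an ascent off `K`, invariance would put the larger `w * swap a b` into the support.
    have hdesc : DescendsOff K w := by
      intro a b hab ha hb
      have hlt : a < b := by rw [Fin.lt_def]; omega
      by_contra hcon
      have hwab : w a < w b := lt_of_le_of_ne (not_lt.1 hcon) (w.injective.ne hlt.ne)
      refine absurd (hmax' (w * swap a b) ?_) (not_le.2 (toLex_lt_mul_swap hlt hwab))
      rwa [← coeff_mul_swap, hq a b hab ha hb]
    have hmem : descentDestroying k w ∈ L := Submodule.subset_span ⟨w, hdesc, rfl⟩
    have hsub : q - q.coeff w • descentDestroying k w ∈ L := by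
      refine hP w hw0 _ (sub_mem hq (Submodule.smul_mem _ _
        (descentDestroying_mem_invariants hdesc))) fun v hv => ?_
      rw [MonoidAlgebra.coeff_sub, MonoidAlgebra.coeff_smul, Finsupp.sub_apply,
        Finsupp.smul_apply, smul_eq_mul] at hv
      refine lt_of_le_of_ne ?_ fun e => ?_
      · by_contra hcon
        refine hv ?_
        rw [not_imp_comm.1 (hmax' v) hcon,
          not_imp_comm.1 toLex_le_of_coeff_descentDestroying_ne_zero hcon]
        simp
      · obtain rfl : v = w := DFunLike.coe_injective (toLex.injective e)
        rw [coeff_descentDestroying_self, mul_one, sub_self] at hv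
        exact hv rfl
    simpa using add_mem hsub (L.smul_mem (q.coeff w) hmem)
  have hP : ∀ w, P w := by
    intro w
    induction w using (InvImage.wf (fun v : Perm (Fin n) => toLex ⇑v) wellFounded_lt).induction with
    | _ w ih => exact fun q hq hlt => key q hq fun v hv => ih v (hlt v hv)
  exact key q hq fun w _ => hP w

theorem invariants_range_eq_top : invariants k n (Finset.range (n + 1)) = ⊤ := by
  refine eq_top_iff.2 fun q _ a b _ ha _ => absurd ?_ ha
  exact Finset.mem_range.2 (by omega)

theorem span_range_descentDestroying :
    ⊤ ≤ Submodule.span k (Set.range (descentDestroying k (n := n))) := by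
  rw [← invariants_range_eq_top (k := k)]
  exact fun q hq => Submodule.span_mono (Set.image_subset_range _ _) (mem_span_of_mem_invariants hq)

/-- A spanning family with as many members as the rank is independent; the rank count needs `k`
nontrivial. -/
theorem linearIndependent_descentDestroying :
    LinearIndependent k (descentDestroying k (n := n)) := by
  rcases subsingleton_or_nontrivial k with _ | _
  · exact linearIndependent_of_subsingleton
  · refine linearIndependent_of_top_le_span_of_card_eq_finrank span_range_descentDestroying ?_
    rw [(MonoidAlgebra.coeffLinearEquiv k).finrank_eq, Module.finrank_finsupp_self]

/-- Take `K` attaining the weight of `w`; a lighter `J` has its invariants spanned by elements of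
weight at most `∑ x ∈ J, x`. -/
theorem exists_descentDestroying_mul_sub_smul_mem (w : Perm (Fin n)) (l : Fin n) :
    ∃ c : k, descentDestroying k w * somewhereToBelow k l - c • descentDestroying k w ∈
      Submodule.span k (descentDestroying k '' {v | weight v < weight w}) := by
  obtain ⟨K, hK, hsum⟩ := exists_sum_eq_weight w
  obtain ⟨c, hc⟩ := exists_mul_somewhereToBelow_sub_smul_mem (k := k) (n := n)
    (L := Submodule.span k (descentDestroying k '' {v | weight v < weight w})) K
    (fun J hJ q hq => Submodule.span_mono (Set.image_mono fun v hv =>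
      (weight_le hv).trans_lt (hsum ▸ hJ)) (mem_span_of_mem_invariants hq)) l
  exact ⟨c, hc _ (descentDestroying_mem_invariants hK)⟩

end SomewhereToBelow

open SomewhereToBelow in
/-- `LinearMap.mulRight k x` is the endomorphism `y ↦ y * x`; `Matrix.BlockTriangular M id` says
that `M i j = 0` whenever `j < i`, i.e. that `M` is upper-triangular. -/
theorem mainTheorem3 (k : Type*) [CommRing k] (n : ℕ) :
    ∃ b : Module.Basis (Fin n.factorial) k (MonoidAlgebra k (Equiv.Perm (Fin n))),
      ∀ c : Fin n → k,
        Matrix.BlockTriangular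
          (LinearMap.toMatrix b b
            (LinearMap.mulRight k (∑ l : Fin n, c l • somewhereToBelow k l))) id := by
  let B := Module.Basis.mk (linearIndependent_descentDestroying (k := k) (n := n))
    span_range_descentDestroying
  have hB : ⇑B = descentDestroying k := Module.Basis.coe_mk _ _
  let e : Equiv.Perm (Fin n) ≃ Fin n.factorial := Fintype.equivFinOfCardEq (by
    rw [Fintype.card_perm, Fintype.card_fin])
  let f : Fin n.factorial → ℕ := fun i => weight (e.symm i)
  -- Ties in weight are harmless: the off-diagonal terms have strictly smaller weight.
  let g : Equiv.Perm (Fin n) ≃ Fin n.factorial := e.trans (Tuple.sort f).symm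
  have hmono : Monotone fun i => weight (g.symm i) := Tuple.monotone_sort f
  refine ⟨B.reindex g, fun c i j hji => ?_⟩
  rw [LinearMap.toMatrix_apply, Module.Basis.repr_reindex_apply, Module.Basis.reindex_apply,
    LinearMap.mulRight_apply, hB]
  set w := g.symm j
  have hw : weight w ≤ weight (g.symm i) := hmono (le_of_lt hji)
  have hne : w ≠ g.symm i := fun h => (ne_of_lt hji) (g.symm.injective h)
  choose d hd using exists_descentDestroying_mul_sub_smul_mem (k := k) w
  have hdecomp : descentDestroying k w * ∑ l : Fin n, c l • somewhereToBelow k l =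
      ∑ l, c l • (descentDestroying k w * somewhereToBelow k l - d l • descentDestroying k w) +
        (∑ l, c l * d l) • descentDestroying k w := by
    simp only [Finset.mul_sum, mul_smul_comm, smul_sub, Finset.sum_sub_distrib, Finset.sum_smul,
      mul_smul, sub_add_cancel]
  have hmem := Submodule.sum_mem _ fun l (_ : l ∈ Finset.univ) =>
    Submodule.smul_mem _ (c l) (hd l)
  rw [← hB, B.mem_span_image] at hmem
  rw [hdecomp, ← hB, map_add, Finsupp.add_apply, map_smul, B.repr_self, Finsupp.smul_apply,
    Finsupp.single_eq_of_ne hne.symm, smul_zero, add_zero]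
  by_contra hcon
  exact absurd (hmem (Finsupp.mem_support_iff.2 hcon)) (not_lt.2 hw)
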